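/- **Model.** There are finitely many keywords $q$, a nonempty finite set of clients $i$, $L$ webpage slots $s$, and for each $q$ a set $\mathcal M_q$ of $0/1$ matrices $M=(M_{is})$ in which every row and every column contains at most one $1$ ($M_{is}=1$ means that client $i$ is shown in slot $s$). In each time slot a query for $q$ arrives with probability $\nu_q=\nu\vartheta_q$ and no query arrives with probability $1-\nu$, independently over time slots, where $\nu\in(0,1)$, $\vartheta_q\ge 0$ and $\sum_q\vartheta_q=1$. Let $c_{qis}\in[0,1]$ be the click-through rates, $m_i\ge 0$ the average impression requirement of client $i$ per requirement cycle, and $N\ge1$ the number of time slots in a cycle. The integer requirement $\tilde m_i(k)$ of client $i$ in cycle $k$ equals $\lceil m_i\rceil$ with probability $m_i-\lfloor m_i\rfloor$ and $\lfloor m_i\rfloor$ otherwise. The vectors $(\tilde m_i(k))_i$ are i.i.d. over $k$ and independent of the queries (for one and the same $k$ their entries may be coupled in any way). **Online algorithm with parameter $\epsilon>0$.** If a query for $q$ arrives in a time slot of cycle $k$, choose $$\tilde M^*\in\arg\max_{M\in\mathcal M_q}\sum_{i,s}M_{is}\Big(\frac{c_{qis}}{\epsilon}+Q_i(k)\Big)$$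 by a fixed rule depending only on the position of the time slot in the cycle, on $q$, and on $\mathbf Q(k)$ (ties are broken arbitrarily). At the end of the cycle set $Q_i(k+1)=[Q_i(k)+\tilde m_i(k)-S_i(k)]^+$, where $S_i(k)$ is the number of impressions of client $i$ in cycle $k$. The credit queues $\mathbf Q(k)$ take values in the nonnegative integer vectors and form a time-homogeneous Markov chain. **Constants.** Let $\mathcal F_0$ be the set of families $\mathbf p=(p_{qM})_{q,\,M\in\mathcal M_q}$ with $0\le p_{qM}\le1$ and $\sum_{M\in\mathcal M_q}p_{qM}\le 1$ for every $q$. Let $$\bar J(\mathbf p)=\sum_q\nu_q\sum_{M\in\mathcal M_q}p_{qM}\sum_{i,s}M_{is}c_{qis},\qquad D_2(\mathbf p)=\min_i\Big\{N\sum_q\nu_q\sum_{M\in\mathcal M_q}p_{qM}\sum_sM_{is}-m_i\Big\},$$ $$D_1=\tfrac12\Big(N(N-1)L^2+NL+\sum_i\big(\lceil m_i\rceil^2(m_i-\lfloor m_i\rfloor)+\lfloor m_i\rfloor^2(1-m_i+\lfloor m_i\rfloor)\big)\Big),$$ $$D_3=N\max_{\mathbf p\in\mathcal F_0}\bar J(\mathbf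 p),\qquad D_2^*=\max_{\mathbf p\in\mathcal F_0}D_2(\mathbf p).$$ Let $\mathcal F$ be the set of those $\mathbf p\in\mathcal F_0$ with $N\sum_q\nu_q\sum_{M\in\mathcal M_q}p_{qM}\sum_sM_{is}\ge m_i$ for all $i$. **Theorem.** Assume that $D_2(\hat{\mathbf p})>0$ for some $\hat{\mathbf p}\in\mathcal F$. Then, under the online algorithm with any $\epsilon>0$, the chain $\mathbf Q(k)$ has a stationary distribution, and for every random vector $\mathbf Q(\infty)$ whose law is a stationary distribution of the chain, $$E\Big[\sum_iQ_i(\infty)\Big]\le\frac1{D_2^*}\Big(D_1+\frac{D_3}{\epsilon}\Big).$$ Moreover, for every deterministic initial state $\mathbf Q(0)$, $$\limsup_{K\to\infty}\frac1K\sum_{k=0}^{K-1}E\Big[\sum_iQ_i(k)\Big]\le\frac1{D_2^*}\Big(D_1+\frac{D_3}{\epsilon}\Big).$$ -/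

import Mathlib

open scoped ENNReal

/-- `M i s = 1` when client `i` occupies webpage slot `s`, and `M i s = 0` otherwise; a slot goes
to at most one client and a client gets at most one slot. -/
def IsAssignment {ι : Type*} [Fintype ι] {L : ℕ} (M : Matrix ι (Fin L) ℕ) : Prop :=
  (∀ i s, M i s = 0 ∨ M i s = 1) ∧ (∀ i, ∑ s, M i s ≤ 1) ∧ (∀ s, ∑ i, M i s ≤ 1)

/-- Randomized rounding of `x ≥ 0` to an integer: `⌈x⌉` with probability `x - ⌊x⌋`, and `⌊x⌋`
otherwise. -/
noncomputable def roundingLaw (x : ℝ) : PMF ℕ :=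
  (PMF.ofFintype
    (fun up : Bool => if up then ENNReal.ofReal (x - ⌊x⌋) else ENNReal.ofReal (1 - (x - ⌊x⌋)))
    (by
      have h := Int.fract_nonneg x
      have h' := Int.fract_lt_one x
      unfold Int.fract at h h'
      simp only [Fintype.sum_bool, if_true, Bool.false_eq_true, if_false]
      rw [← ENNReal.ofReal_add h (by linarith)]
      simp)).map
    fun up => if up then ⌈x⌉₊ else ⌊x⌋₊

/-- The click-through-rate maximization model with impression requirements, for the finite set `κ`
of keywords and the finite set `ι` of clients. -/
structure AdModel (κ ι : Type*) [Fintype κ] [Fintype ι] where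
  /-- number of webpage slots -/
  L : ℕ
  /-- number of time slots in a requirement cycle -/
  N : ℕ
  N_pos : 0 < N
  /-- probability that a query arrives in a time slot -/
  arrival : ℝ
  arrival_pos : 0 < arrival
  arrival_lt_one : arrival < 1
  /-- probability that an arriving query is for a given keyword -/
  share : κ → ℝ
  share_nonneg : ∀ q, 0 ≤ share q
  share_sum : ∑ q, share q = 1
  /-- click-through rates -/
  ctr : κ → ι → Fin L → ℝ
  ctr_nonneg : ∀ q i s, 0 ≤ ctr q i s
  ctr_le_one : ∀ q i s, ctr q i s ≤ 1
  /-- the assignment matrices admitted for a keyword -/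
  mats : κ → Finset (Matrix ι (Fin L) ℕ)
  isAssignment_of_mem : ∀ q, ∀ M ∈ mats q, IsAssignment M
  /-- average impression requirement per requirement cycle -/
  m : ι → ℝ
  m_nonneg : ∀ i, 0 ≤ m i
  /-- joint law, in one requirement cycle, of the integer-valued requirements of the clients;
  only its marginals are prescribed, the clients may be coupled or independent -/
  reqLaw : PMF (ι → ℕ)
  reqLaw_marginal : ∀ i, reqLaw.map (fun r => r i) = roundingLaw (m i)

namespace AdModel

variable {κ ι : Type*} [Fintype κ] [Fintype ι] (A : AdModel κ ι)

/-- Arrival rate of queries for keyword `q`. -/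
def rate (q : κ) : ℝ := A.arrival * A.share q

/-! ### The static optimization problem -/

/-- Families `p = (p q M)`, `M` ranging over the matrices admitted for the keyword `q`. -/
abbrev Policy : Type _ := (q : κ) → {M // M ∈ A.mats q} → ℝ

/-- Average total click-through rate (per time slot). -/
def clickRate (p : A.Policy) : ℝ :=
  ∑ q, A.rate q * ∑ M : {M // M ∈ A.mats q}, p q M *
    ∑ i, ∑ s, (M.1 i s : ℝ) * A.ctr q i s

/-- Average number of impressions of client `i` per requirement cycle. -/
def impressions (p : A.Policy) (i : ι) : ℝ :=
  A.N * ∑ q, A.rate q * ∑ M : {M // M ∈ A.mats q}, p q M * ∑ s, (M.1 i s : ℝ)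

/-- The relaxed feasible set, without the impression requirements. -/
def relaxedFeasible : Set A.Policy :=
  {p | (∀ q M, 0 ≤ p q M ∧ p q M ≤ 1) ∧ ∀ q, ∑ M, p q M ≤ 1}

/-- The feasible set. -/
def feasible : Set A.Policy :=
  {p | p ∈ A.relaxedFeasible ∧ ∀ i, A.m i ≤ A.impressions p i}

/-! ### The constants -/

noncomputable def D₁ : ℝ :=
  (1 / 2) * ((A.N : ℝ) * ((A.N : ℝ) - 1) * (A.L : ℝ) ^ 2 + (A.N : ℝ) * (A.L : ℝ)
    + ∑ i, ((⌈A.m i⌉ : ℝ) ^ 2 * (A.m i - (⌊A.m i⌋ : ℝ))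
        + (⌊A.m i⌋ : ℝ) ^ 2 * (1 - A.m i + (⌊A.m i⌋ : ℝ))))

/-- The least surplus of impressions over all clients. -/
noncomputable def D₂ [Nonempty ι] (p : A.Policy) : ℝ :=
  Finset.univ.inf' Finset.univ_nonempty fun i => A.impressions p i - A.m i

/-- The maximum of `D₂` over the relaxed feasible set (attained: see `isGreatest_D₂max`). -/
noncomputable def D₂max [Nonempty ι] : ℝ := sSup (A.D₂ '' A.relaxedFeasible)

/-- `N` times the maximal click-through rate over the relaxed feasible set (attained: see
`isGreatest_clickRate`). -/
noncomputable def D₃ : ℝ := A.N * sSup (A.clickRate '' A.relaxedFeasible)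

theorem isCompact_relaxedFeasible : IsCompact A.relaxedFeasible := by
  have h1 : IsCompact (Set.univ.pi fun q : κ => Set.univ.pi
      fun _ : {M // M ∈ A.mats q} => Set.Icc (0 : ℝ) 1) :=
    isCompact_univ_pi fun q => isCompact_univ_pi fun _ => isCompact_Icc
  have h2 : IsClosed {p : A.Policy | ∀ q, ∑ M, p q M ≤ 1} := by
    rw [show {p : A.Policy | ∀ q, ∑ M, p q M ≤ 1} = ⋂ q, {p : A.Policy | ∑ M, p q M ≤ 1} by
      ext; simp]
    exact isClosed_iInter fun q => isClosed_le (by fun_prop) continuous_const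
  convert h1.inter_right h2 using 1
  ext p
  simp only [relaxedFeasible, Set.mem_inter_iff, Set.mem_univ_pi, Set.mem_Icc, Set.mem_ofPred_eq]

theorem relaxedFeasible_nonempty : A.relaxedFeasible.Nonempty :=
  ⟨fun _ _ => 0, by simp [relaxedFeasible]⟩

theorem isGreatest_clickRate :
    IsGreatest (A.clickRate '' A.relaxedFeasible) (sSup (A.clickRate '' A.relaxedFeasible)) :=
  (A.isCompact_relaxedFeasible.image (by unfold clickRate; fun_prop)).isGreatest_sSup
    (A.relaxedFeasible_nonempty.image _)

theorem isGreatest_D₂max [Nonempty ι] : IsGreatest (A.D₂ '' A.relaxedFeasible) A.D₂max :=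
  (A.isCompact_relaxedFeasible.image (by
    unfold D₂
    refine Continuous.finset_inf'_apply _ fun i _ => ?_
    unfold impressions
    fun_prop)).isGreatest_sSup (A.relaxedFeasible_nonempty.image _)

/-! ### The stochastic model and the online algorithm -/

/-- Law of the query in one time slot; `none` means that no query arrives. -/
noncomputable def queryLaw : PMF (Option κ) :=
  PMF.ofFintype
    (fun o => o.elim (ENNReal.ofReal (1 - A.arrival)) fun q => ENNReal.ofReal (A.rate q))
    (by
      have h0 : ∀ q, 0 ≤ A.rate q := fun q => mul_nonneg A.arrival_pos.le (A.share_nonneg q)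
      rw [Fintype.sum_option]
      simp only [Option.elim]
      rw [← ENNReal.ofReal_sum_of_nonneg fun q _ => h0 q,
        ← ENNReal.ofReal_add (by linarith [A.arrival_lt_one]) (Finset.sum_nonneg fun q _ => h0 q)]
      simp [rate, ← Finset.mul_sum, A.share_sum])

/-- Law of the queries in one requirement cycle: independent over the `N` time slots. -/
noncomputable def cycleQueryLaw : PMF (Fin A.N → Option κ) :=
  PMF.ofFintype (fun u => ∏ j, A.queryLaw (u j)) (by
    classical
    rw [← Fintype.piFinset_univ, ← Finset.prod_univ_sum]
    refine Finset.prod_eq_one fun j _ => ?_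
    rw [← tsum_fintype (L := .unconditional _)]
    exact A.queryLaw.tsum_coe)

/-- A rule that chooses, in the `j`-th time slot of a requirement cycle, an assignment matrix from
the queried keyword and the credit queues at the beginning of the cycle. -/
abbrev Rule : Type _ := Fin A.N → κ → (ι → ℕ) → Matrix ι (Fin A.L) ℕ

/-- The rules of the online algorithm with parameter `ε`: the chosen matrix is an admitted matrix
of maximal weight, ties being broken arbitrarily. -/
def IsOnline (ε : ℝ) (rule : A.Rule) : Prop :=
  ∀ j q Q, rule j q Q ∈ A.mats q ∧ ∀ M ∈ A.mats q,
    ∑ i, ∑ s, (M i s : ℝ) * (A.ctr q i s / ε + (Q i : ℝ))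
      ≤ ∑ i, ∑ s, (rule j q Q i s : ℝ) * (A.ctr q i s / ε + (Q i : ℝ))

variable {A}

/-- Number of impressions of client `i` in a requirement cycle with queries `u`, when the queues at
the beginning of the cycle are `Q`. -/
def served (rule : A.Rule) (Q : ι → ℕ) (u : Fin A.N → Option κ) (i : ι) : ℕ :=
  ∑ j, (u j).elim 0 fun q => ∑ s, rule j q Q i s

/-- The update of the credit queues at the end of a requirement cycle. Subtraction of natural
numbers is truncated at `0`, so this is `[Q i + r i - served i]⁺`. -/
def update (rule : A.Rule) (Q : ι → ℕ) (u : Fin A.N → Option κ) (r : ι → ℕ) : ι → ℕ :=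
  fun i => Q i + r i - served rule Q u i

/-- Transition law of the Markov chain of credit queues: the queries and the requirements of a cycle
are independent of each other and of the past. -/
noncomputable def step (rule : A.Rule) (Q : ι → ℕ) : PMF (ι → ℕ) :=
  A.cycleQueryLaw.bind fun u => A.reqLaw.map fun r => update rule Q u r

/-- Law of the queues at the beginning of cycle `k`, started from the queues `Q₀`. -/
noncomputable def queueLaw (rule : A.Rule) (Q₀ : ι → ℕ) : ℕ → PMF (ι → ℕ)
  | 0 => PMF.pure Q₀
  | k + 1 => (queueLaw rule Q₀ k).bind (step rule)

/-- `π` is a steady-state law (stationary distribution) of the queues. -/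
def IsSteadyState (rule : A.Rule) (π : PMF (ι → ℕ)) : Prop :=
  π.bind (step rule) = π

end AdModel

/-- Expected total queue length `E[∑ i, Q i]`, in `[0, ∞]`, for queues `Q` with law `μ`. -/
noncomputable def meanTotal {ι : Type*} [Fintype ι] (μ : PMF (ι → ℕ)) : ℝ≥0∞ :=
  ∑' Q : ι → ℕ, μ Q * ((∑ i, Q i : ℕ) : ℝ≥0∞)

/-! ### Expectations and Markov chains on a discrete state space -/

section DiscreteChain

open Filter Topology

variable {α β : Type*}

/-! The proof is a Foster–Lyapunov argument with `W Q = ∑ i, Q i ^ 2`. Expanding the square of the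
update, the terms in `r ^ 2` and `served ^ 2` contribute at most `2 * D₁` in mean, and the cross
term is twice `∑ i, Q i * (m i - E[served i])`. The queues are frozen during a cycle, so the rule
maximizes the weight query by query and does at least as well as any static randomized policy.
Compared with a maximizer of `D₂`, its queue-weighted service can fall short only by the click part
of the weight, at most `D₃ / ε`. Hence `E[W(next)] + 2 * D₂max * ∑ Q ≤ W(Q) + 2 * (D₁ + D₃ / ε)`
(`AdModel.tsum_step_sq_drift`).

All three conclusions follow from this inequality: the Cesàro bound by telescoping, the stationary
bound by truncation (`PMF.tsum_mul_le_of_drift`), existence by tightness of the time averages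
(`PMF.exists_stationary_of_drift`). No irreducibility is needed. Expectations live in `ℝ≥0∞`, so
integrability never has to be checked beforehand. -/

theorem PMF.tsum_bind_mul (μ : PMF α) (P : α → PMF β) (f : β → ℝ≥0∞) :
    ∑' b, μ.bind P b * f b = ∑' a, μ a * ∑' b, P a b * f b := by
  simp_rw [PMF.bind_apply, ← ENNReal.tsum_mul_right, ← ENNReal.tsum_mul_left, mul_assoc]
  exact ENNReal.tsum_comm

theorem PMF.tsum_pure_mul (a : α) (f : α → ℝ≥0∞) : ∑' b, PMF.pure a b * f b = f a := by
  rw [tsum_eq_single a]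
  · simp
  · intro b hb
    simp [hb]

theorem PMF.tsum_map_mul (μ : PMF α) (g : α → β) (f : β → ℝ≥0∞) :
    ∑' b, μ.map g b * f b = ∑' a, μ a * f (g a) := by
  rw [PMF.map, PMF.tsum_bind_mul]
  simp only [Function.comp_apply, PMF.tsum_pure_mul]

theorem PMF.tsum_mul_const (μ : PMF α) (c : ℝ≥0∞) : ∑' a, μ a * c = c := by
  rw [ENNReal.tsum_mul_right, μ.tsum_coe, one_mul]

/-- Both total masses are 1, which leaves no room for a strict inequality. Invariance of a law thus
needs only one inequality. -/
theorem PMF.eq_of_le {μ ν : PMF α} (h : ∀ a, μ a ≤ ν a) : μ = ν := by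
  ext a
  by_contra hne
  have hlt : μ a < ν a := lt_of_le_of_ne (h a) hne
  have := ENNReal.tsum_lt_tsum (by rw [μ.tsum_coe]; exact ENNReal.one_ne_top) h hlt
  rw [μ.tsum_coe, ν.tsum_coe] at this
  exact lt_irrefl _ this

/-- Law after `k` steps of the chain with transition law `P` started from `a`. -/
noncomputable def PMF.nStep (P : α → PMF α) (a : α) : ℕ → PMF α
  | 0 => PMF.pure a
  | k + 1 => (PMF.nStep P a k).bind P

theorem PMF.bind_nStep_of_stationary {P : α → PMF α} {π : PMF α} (hπ : π.bind P = π) (k : ℕ) :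
    (π.bind fun a => PMF.nStep P a k) = π := by
  induction k with
  | zero => simp [PMF.nStep]
  | succ k ih =>
    simp only [PMF.nStep]
    rw [← PMF.bind_bind, ih, hπ]

/-! ### Consequences of a drift inequality -/

section Drift

variable {P : α → PMF α} {f : α → ℕ} {W : α → ℝ≥0∞} {d b : ℝ≥0∞}

/-- Telescoped drift. The `W` term stays on the left because subtraction in `ℝ≥0∞` truncates. -/
theorem PMF.sum_nStep_le_of_drift
    (hdrift : ∀ a, ∑' x, P a x * W x + d * (f a : ℝ≥0∞) ≤ W a + b) (a : α) (K : ℕ) :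
    ∑' x, PMF.nStep P a K x * W x
      + d * ∑ k ∈ Finset.range K, ∑' x, PMF.nStep P a k x * (f x : ℝ≥0∞) ≤ W a + K * b := by
  induction K with
  | zero => simp [PMF.nStep]
  | succ K ih =>
    have h1 : ∑' x, PMF.nStep P a (K + 1) x * W x
        + d * ∑' x, PMF.nStep P a K x * (f x : ℝ≥0∞) ≤ ∑' x, PMF.nStep P a K x * W x + b := by
      rw [PMF.nStep, PMF.tsum_bind_mul, ← ENNReal.tsum_mul_left, ← ENNReal.tsum_add]
      calc _ ≤ ∑' x, (PMF.nStep P a K x * W x + PMF.nStep P a K x * b) := by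
            refine ENNReal.tsum_le_tsum fun x => ?_
            rw [mul_left_comm, ← mul_add, ← mul_add]
            exact mul_le_mul' le_rfl (hdrift x)
        _ = _ := by rw [ENNReal.tsum_add, PMF.tsum_mul_const]
    rw [Finset.sum_range_succ, mul_add]
    calc _ = (∑' x, PMF.nStep P a (K + 1) x * W x
          + d * ∑' x, PMF.nStep P a K x * (f x : ℝ≥0∞))
          + d * ∑ k ∈ Finset.range K, ∑' x, PMF.nStep P a k x * (f x : ℝ≥0∞) := by ring
      _ ≤ (∑' x, PMF.nStep P a K x * W x + b)
          + d * ∑ k ∈ Finset.range K, ∑' x, PMF.nStep P a k x * (f x : ℝ≥0∞) := by gcongr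
      _ = (∑' x, PMF.nStep P a K x * W x
          + d * ∑ k ∈ Finset.range K, ∑' x, PMF.nStep P a k x * (f x : ℝ≥0∞)) + b := by ring
      _ ≤ (W a + K * b) + b := by gcongr
      _ = _ := by push_cast; ring

theorem PMF.average_nStep_le_of_drift (hd : d ≠ 0) (hd' : d ≠ ∞)
    (hdrift : ∀ a, ∑' x, P a x * W x + d * (f a : ℝ≥0∞) ≤ W a + b) (a : α) {K : ℕ} (hK : K ≠ 0) :
    (∑ k ∈ Finset.range K, ∑' x, PMF.nStep P a k x * (f x : ℝ≥0∞)) / K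
      ≤ W a / d / K + b / d := by
  have hK' : (K : ℝ≥0∞) ≠ 0 := by exact_mod_cast hK
  have hKt : (K : ℝ≥0∞) ≠ ∞ := ENNReal.natCast_ne_top K
  have h := le_trans le_add_self (PMF.sum_nStep_le_of_drift hdrift a K)
  rw [ENNReal.div_le_iff hK' hKt, add_mul, ENNReal.div_mul_cancel hK' hKt]
  calc _ ≤ (W a + K * b) / d := by
        rw [ENNReal.le_div_iff_mul_le (Or.inl hd) (Or.inl hd'), mul_comm]
        exact h
    _ = _ := by rw [ENNReal.add_div, mul_div_assoc, mul_comm (K : ℝ≥0∞)]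

theorem tendsto_const_div_natCast_add {c e : ℝ≥0∞} (hc : c ≠ ∞) :
    Tendsto (fun K : ℕ => c / K + e) atTop (𝓝 e) := by
  have h := (ENNReal.Tendsto.const_div (a := c) ENNReal.tendsto_nat_nhds_top
    (Or.inr hc)).add_const e
  simpa using h

theorem PMF.limsup_average_nStep_le_of_drift (hd : d ≠ 0) (hd' : d ≠ ∞) (hW : ∀ a, W a ≠ ∞)
    (hdrift : ∀ a, ∑' x, P a x * W x + d * (f a : ℝ≥0∞) ≤ W a + b) (a : α) :
    limsup (fun K : ℕ =>
      (∑ k ∈ Finset.range K, ∑' x, PMF.nStep P a k x * (f x : ℝ≥0∞)) / (K : ℝ≥0∞)) atTop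
      ≤ b / d := by
  rw [← (tendsto_const_div_natCast_add (e := b / d)
    (ENNReal.div_ne_top (hW a) hd)).limsup_eq]
  refine limsup_le_limsup ?_
  filter_upwards [eventually_ne_atTop 0] with K hK
  exact PMF.average_nStep_le_of_drift hd hd' hdrift a hK

/-- Moment bound for stationary laws; the Lyapunov function need not be integrable. -/
theorem PMF.tsum_mul_le_of_drift (hd : d ≠ 0) (hd' : d ≠ ∞) (hW : ∀ a, W a ≠ ∞)
    (hdrift : ∀ a, ∑' x, P a x * W x + d * (f a : ℝ≥0∞) ≤ W a + b)
    {π : PMF α} (hπ : π.bind P = π) : ∑' x, π x * (f x : ℝ≥0∞) ≤ b / d := by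
  -- The mean of `W` under `π` may be infinite, so the drift cannot be integrated against `π`; the
  -- bounded function `min f n` can.
  have htrunc : ∀ n : ℕ, ∑' x, π x * min (f x : ℝ≥0∞) n ≤ b / d := by
    intro n
    have hbound : ∀ K : ℕ, K ≠ 0 → ∑' x, π x * min (f x : ℝ≥0∞) n
        ≤ ∑' a, π a * min (W a / d / K + b / d) n := by
      intro K hK
      have hK' : (K : ℝ≥0∞) ≠ 0 := by exact_mod_cast hK
      have hKt : (K : ℝ≥0∞) ≠ ∞ := ENNReal.natCast_ne_top K
      have h1 : ∀ k, ∑' x, π x * min (f x : ℝ≥0∞) n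
          = ∑' a, π a * ∑' x, PMF.nStep P a k x * min (f x : ℝ≥0∞) n := by
        intro k
        rw [← PMF.tsum_bind_mul, PMF.bind_nStep_of_stationary hπ]
      -- By stationarity the mean is the same at every time, hence equals its own time average,
      -- taken conditionally on the initial state `a`.
      have h2 : ∑' x, π x * min (f x : ℝ≥0∞) n = ∑' a, π a *
          ((∑ k ∈ Finset.range K, ∑' x, PMF.nStep P a k x * min (f x : ℝ≥0∞) n) / K) := by
        simp_rw [← mul_div_assoc, div_eq_mul_inv, Finset.mul_sum]
        rw [ENNReal.tsum_mul_right, Summable.tsum_finsetSum fun _ _ => ENNReal.summable,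
          Finset.sum_congr rfl fun k _ => (h1 k).symm, Finset.sum_const, Finset.card_range,
          nsmul_eq_mul, mul_right_comm, ENNReal.mul_inv_cancel hK' hKt, one_mul]
      rw [h2]
      refine ENNReal.tsum_le_tsum fun a => ?_
      gcongr
      refine le_min ?_ ?_
      · refine le_trans ?_ (PMF.average_nStep_le_of_drift hd hd' hdrift a hK)
        gcongr
        exact min_le_left _ _
      · rw [ENNReal.div_le_iff hK' hKt]
        calc _ ≤ ∑ k ∈ Finset.range K, (n : ℝ≥0∞) := by
              refine Finset.sum_le_sum fun k _ => ?_
              conv_rhs => rw [← PMF.tsum_mul_const (PMF.nStep P a k) (n : ℝ≥0∞)]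
              gcongr
              exact min_le_right _ _
          _ = _ := by rw [Finset.sum_const, Finset.card_range, nsmul_eq_mul, mul_comm]
    -- Dominated convergence with the constant bound `n`: for each fixed `a` the term `W a / d / K`
    -- vanishes as `K → ∞`.
    have hlim : Tendsto (fun K : ℕ => ∑' a, π a * min (W a / d / K + b / d) n) atTop
        (𝓝 (∑' a, π a * min (b / d) n)) := by
      let _ : MeasurableSpace α := ⊤
      have hms : MeasurableSingletonClass α := ⟨fun _ => trivial⟩
      simp_rw [← MeasureTheory.lintegral_count]
      refine MeasureTheory.tendsto_lintegral_of_dominated_convergence (fun a => π a * n)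
        (fun _ => measurable_from_top) (fun _ => .of_forall fun a => ?_) ?_
        (.of_forall fun a => ?_)
      · dsimp only
        gcongr
        exact min_le_right _ _
      · rw [MeasureTheory.lintegral_count, PMF.tsum_mul_const]
        exact ENNReal.natCast_ne_top n
      · refine ENNReal.Tendsto.const_mul ?_ (Or.inr (π.apply_ne_top a))
        exact (tendsto_const_div_natCast_add (ENNReal.div_ne_top (hW a) hd)).min
          tendsto_const_nhds
    refine (ge_of_tendsto hlim ((eventually_ne_atTop 0).mono hbound)).trans ?_
    calc _ ≤ ∑' a, π a * (b / d) := by gcongr; exact min_le_left _ _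
      _ = _ := PMF.tsum_mul_const _ _
  rw [ENNReal.tsum_eq_iSup_sum]
  refine iSup_le fun s => ?_
  -- On the finite set `s`, truncation at `s.sup f` changes nothing.
  refine le_trans ?_ (htrunc (s.sup f))
  refine le_trans (Finset.sum_le_sum fun x hx => ?_) (ENNReal.sum_le_tsum s)
  gcongr
  exact le_min le_rfl (by exact_mod_cast Finset.le_sup hx)

/-- Markov's inequality on a finite sublevel set. -/
theorem PMF.one_le_sum_add_of_tsum_le (μ : PMF α) {n : ℕ}
    (s : Finset α) (hs : ∀ a, f a ≤ n → a ∈ s) :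
    n ≤ n * ∑ a ∈ s, μ a + ∑' a, μ a * (f a : ℝ≥0∞) := by
  classical
  conv_lhs => rw [← PMF.tsum_mul_const μ (n : ℝ≥0∞)]
  rw [Finset.mul_sum, sum_eq_tsum_indicator, ← ENNReal.tsum_add]
  refine ENNReal.tsum_le_tsum fun a => ?_
  by_cases ha : a ∈ s
  · simp [ha, mul_comm]
  · have : n ≤ f a := (not_le.1 fun h => ha (hs a h)).le
    refine le_add_left ?_
    gcongr

/-- Krylov–Bogoliubov existence of a stationary law under a drift condition. -/
theorem PMF.exists_stationary_of_drift (hd : d ≠ 0) (hd' : d ≠ ∞) (hb : b ≠ ∞)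
    (hW : ∀ a, W a ≠ ∞) (hf : ∀ n, {a | f a ≤ n}.Finite)
    (hdrift : ∀ a, ∑' x, P a x * W x + d * (f a : ℝ≥0∞) ≤ W a + b) (a₀ : α) :
    ∃ π : PMF α, π.bind P = π := by
  classical
  set avg : ℕ → α → ℝ≥0∞ := fun K x => (∑ k ∈ Finset.range K, PMF.nStep P a₀ k x) / K with havg
  have htsum : ∀ (K : ℕ) (g : α → ℝ≥0∞), ∑' x, avg K x * g x
      = (∑ k ∈ Finset.range K, ∑' x, PMF.nStep P a₀ k x * g x) / K := by
    intro K g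
    simp only [havg, div_eq_mul_inv, Finset.sum_mul]
    rw [Summable.tsum_finsetSum fun _ _ => ENNReal.summable]
    refine Finset.sum_congr rfl fun k _ => ?_
    rw [← ENNReal.tsum_mul_right]
    exact tsum_congr fun x => by ring
  have hcancel : ∀ {K : ℕ} (_ : K ≠ 0) (c : ℝ≥0∞), (K : ℝ≥0∞) * c / K = c := by
    intro K hK c
    rw [mul_comm]
    exact ENNReal.mul_div_cancel_right (by exact_mod_cast hK) (ENNReal.natCast_ne_top K)
  -- Compactness of `[0, ∞]` gives a limit along `U` at every state at once, with no diagonal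
  -- extraction.
  let U : Ultrafilter ℕ := Filter.hyperfilter ℕ
  have hU : (U : Filter ℕ) ≤ atTop := by
    rw [← Nat.cofinite_eq_atTop]
    exact Filter.hyperfilter_le_cofinite
  have hex : ∀ x, ∃ p, Tendsto (fun K => avg K x) U (𝓝 p) := fun x =>
    ⟨_, Ultrafilter.le_nhds_lim (U.map fun K => avg K x)⟩
  choose p hp using hex
  have hne : ∀ᶠ K in (U : Filter ℕ), K ≠ 0 := hU (eventually_ne_atTop 0)
  have hone : ∀ K : ℕ, K ≠ 0 → ∑' x, avg K x = 1 := by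
    intro K hK
    have := htsum K 1
    simp only [Pi.one_apply, mul_one, PMF.tsum_coe, Finset.sum_const, Finset.card_range,
      nsmul_eq_mul] at this
    rw [this]
    exact ENNReal.div_self (by exact_mod_cast hK) (ENNReal.natCast_ne_top K)
  have hple : ∑' x, p x ≤ 1 := by
    rw [ENNReal.tsum_eq_iSup_sum]
    refine iSup_le fun s => le_of_tendsto (tendsto_finsetSum s fun x _ => hp x) ?_
    filter_upwards [hne] with K hK
    exact (ENNReal.sum_le_tsum s).trans (hone K hK).le
  set C := W a₀ / d + b / d with hC
  have hCt : C ≠ ∞ := ENNReal.add_ne_top.2 ⟨ENNReal.div_ne_top (hW a₀) hd, ENNReal.div_ne_top hb hd⟩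
  -- Tightness: the averages put mass at least `1 - C / n` on the finite set `{f ≤ n}`, so no mass
  -- escapes in the limit.
  have hpge : 1 ≤ ∑' x, p x := by
    have key : ∀ n : ℕ, n ≠ 0 → 1 ≤ C / n + ∑' x, p x := by
      intro n hn
      have hn' : (n : ℝ≥0∞) ≠ 0 := by exact_mod_cast hn
      have hnt : (n : ℝ≥0∞) ≠ ∞ := ENNReal.natCast_ne_top n
      set s := (hf n).toFinset with hs
      have hlim : Tendsto (fun K => n * ∑ x ∈ s, avg K x + C) U (𝓝 (n * ∑ x ∈ s, p x + C)) :=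
        (ENNReal.Tendsto.const_mul (tendsto_finsetSum s fun x _ => hp x) (Or.inr hnt)).add_const C
      have hle : (n : ℝ≥0∞) ≤ n * ∑ x ∈ s, p x + C := by
        refine ge_of_tendsto hlim ?_
        filter_upwards [hne] with K hK
        have hKt : (K : ℝ≥0∞) ≠ ∞ := ENNReal.natCast_ne_top K
        calc (n : ℝ≥0∞) = (∑ k ∈ Finset.range K, (n : ℝ≥0∞)) / K := by
              rw [Finset.sum_const, Finset.card_range, nsmul_eq_mul, hcancel hK]
          _ ≤ (∑ k ∈ Finset.range K, (n * ∑ x ∈ s, PMF.nStep P a₀ k x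
                + ∑' x, PMF.nStep P a₀ k x * (f x : ℝ≥0∞))) / K := by
              gcongr with k _
              exact PMF.one_le_sum_add_of_tsum_le _ s fun a ha => by simpa [hs] using ha
          _ = n * ∑ x ∈ s, avg K x
                + (∑ k ∈ Finset.range K, ∑' x, PMF.nStep P a₀ k x * (f x : ℝ≥0∞)) / K := by
              rw [Finset.sum_add_distrib, ENNReal.add_div, ← Finset.mul_sum, Finset.sum_comm,
                mul_div_assoc]
              simp only [havg, div_eq_mul_inv, Finset.sum_mul]
          _ ≤ n * ∑ x ∈ s, avg K x + C := by
              gcongr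
              refine (PMF.average_nStep_le_of_drift hd hd' hdrift a₀ hK).trans ?_
              refine add_le_add (ENNReal.div_le_of_le_mul (le_mul_of_one_le_right' ?_)) le_rfl
              exact_mod_cast Nat.one_le_iff_ne_zero.2 hK
      calc (1 : ℝ≥0∞) = n / n := (ENNReal.div_self hn' hnt).symm
        _ ≤ (n * ∑ x ∈ s, p x + C) / n := by gcongr
        _ = C / n + ∑ x ∈ s, p x := by rw [ENNReal.add_div, hcancel hn, add_comm]
        _ ≤ _ := by gcongr; exact ENNReal.sum_le_tsum s
    exact ge_of_tendsto (tendsto_const_div_natCast_add hCt) ((eventually_ne_atTop 0).mono key)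
  let π : PMF α := ⟨p, by
    rw [← le_antisymm hple hpge]
    exact ENNReal.summable.hasSum⟩
  -- One step moves the time average up by at most `1 / K` at each state. Finite partial sums pass
  -- to the limit and give only `π P ≤ π`, which suffices for two probability laws.
  refine ⟨π, PMF.eq_of_le fun x => ?_⟩
  rw [PMF.bind_apply, ENNReal.tsum_eq_iSup_sum]
  refine iSup_le fun s => ?_
  have hlim1 : Tendsto (fun K => ∑ y ∈ s, avg K y * P y x) U (𝓝 (∑ y ∈ s, p y * P y x)) :=
    tendsto_finsetSum s fun y _ =>
      ENNReal.Tendsto.mul_const (hp y) (Or.inr ((P y).apply_ne_top x))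
  have hlim2 : Tendsto (fun K : ℕ => avg K x + (1 / (K : ℝ≥0∞) + 0)) U (𝓝 (p x + 0)) :=
    (hp x).add ((tendsto_const_div_natCast_add ENNReal.one_ne_top).mono_left hU)
  rw [add_zero] at hlim2
  refine le_of_tendsto_of_tendsto' hlim1 hlim2 fun K => ?_
  calc ∑ y ∈ s, avg K y * P y x ≤ ∑' y, avg K y * P y x := ENNReal.sum_le_tsum s
    _ = (∑ k ∈ Finset.range K, PMF.nStep P a₀ (k + 1) x) / K := by
        rw [htsum]
        simp only [PMF.nStep, PMF.bind_apply]
    _ ≤ (∑ k ∈ Finset.range K, PMF.nStep P a₀ k x + 1) / K := by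
        gcongr
        calc _ ≤ ∑ k ∈ Finset.range (K + 1), PMF.nStep P a₀ k x := by
              rw [Finset.sum_range_succ']
              exact le_self_add
          _ ≤ _ := by
              rw [Finset.sum_range_succ]
              gcongr
              exact PMF.coe_le_one _ x
    _ = _ := by rw [ENNReal.add_div, add_zero]

end Drift

end DiscreteChain

namespace AdModel

variable {κ ι : Type*} [Fintype κ] [Fintype ι] {A : AdModel κ ι}

/-! ### Pointwise estimates -/

theorem sum_sum_le_of_isAssignment {L : ℕ} {M : Matrix ι (Fin L) ℕ} (hM : IsAssignment M) :
    ∑ i, ∑ s, M i s ≤ L := by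
  calc ∑ i, ∑ s, M i s = ∑ s, ∑ i, M i s := Finset.sum_comm
    _ ≤ ∑ _s : Fin L, 1 := Finset.sum_le_sum fun s _ => hM.2.2 s
    _ = L := by simp

/-- A client is shown at most once per time slot, so each count is at most `N`; the counts sum to at
most `N * L`. Their squares therefore sum to at most `N * (N * L)`, and `L ≤ L ^ 2` then yields the
form used in `D₁`. -/
theorem sum_served_sq_le {rule : A.Rule} (hrule : ∀ j q Q, rule j q Q ∈ A.mats q)
    (Q : ι → ℕ) (u : Fin A.N → Option κ) :
    ∑ i, served rule Q u i ^ 2 ≤ A.N * (A.N - 1) * A.L ^ 2 + A.N * A.L := by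
  have h1 : ∀ i, served rule Q u i ≤ A.N := fun i => by
    have : served rule Q u i ≤ ∑ _j : Fin A.N, 1 := by
      refine Finset.sum_le_sum fun j _ => ?_
      cases u j with
      | none => simp
      | some q => exact (A.isAssignment_of_mem q _ (hrule j q Q)).2.1 i
    simpa using this
  have h2 : ∑ i, served rule Q u i ≤ A.N * A.L := by
    have : ∑ i, served rule Q u i ≤ ∑ _j : Fin A.N, A.L := by
      unfold served
      rw [Finset.sum_comm]
      refine Finset.sum_le_sum fun j _ => ?_
      cases u j with
      | none => simp
      | some q => exact sum_sum_le_of_isAssignment (A.isAssignment_of_mem q _ (hrule j q Q))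
    simpa using this
  calc ∑ i, served rule Q u i ^ 2 ≤ ∑ i, A.N * served rule Q u i :=
        Finset.sum_le_sum fun i _ => by rw [sq]; exact Nat.mul_le_mul_right _ (h1 i)
    _ = A.N * ∑ i, served rule Q u i := (Finset.mul_sum ..).symm
    _ ≤ A.N * (A.N * A.L) := Nat.mul_le_mul_left _ h2
    _ = A.N * (A.N - 1) * A.L + A.N * A.L := by
        obtain ⟨n, hn⟩ := Nat.exists_eq_succ_of_ne_zero A.N_pos.ne'
        rw [hn]
        simp only [Nat.succ_eq_add_one, Nat.add_sub_cancel]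
        ring
    _ ≤ _ := by
        gcongr
        exact Nat.le_self_pow two_ne_zero _

/-- Without truncation the two sides differ by `2 * r * s ≥ 0`, and truncation only lowers the
square. The cross term is on the left so that everything stays in `ℕ`. -/
theorem sub_sq_add_le (a r s : ℕ) :
    (a + r - s) ^ 2 + 2 * (a * s) ≤ a ^ 2 + (2 * a * r + r ^ 2) + s ^ 2 := by
  rcases le_total s (a + r) with h | h
  · obtain ⟨t, ht⟩ := Nat.exists_eq_add_of_le h
    rw [ht, Nat.add_sub_cancel_left]
    zify at ht ⊢
    have : (t : ℤ) = a + r - s := by linarith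
    rw [this]
    have : (0 : ℤ) ≤ r * s := by positivity
    nlinarith
  · rw [Nat.sub_eq_zero_of_le h]
    zify
    have : (0 : ℤ) ≤ r * s := by positivity
    nlinarith [sq_nonneg ((a : ℤ) + r - s)]

theorem sum_update_sq_add_le {rule : A.Rule} (hrule : ∀ j q Q, rule j q Q ∈ A.mats q)
    (Q : ι → ℕ) (u : Fin A.N → Option κ) (r : ι → ℕ) :
    ∑ i, update rule Q u r i ^ 2 + 2 * ∑ i, Q i * served rule Q u i
      ≤ (∑ i, Q i ^ 2 + (A.N * (A.N - 1) * A.L ^ 2 + A.N * A.L))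
        + ∑ i, (2 * Q i * r i + r i ^ 2) := by
  have h : ∑ i, (update rule Q u r i ^ 2 + 2 * (Q i * served rule Q u i))
      ≤ ∑ i, (Q i ^ 2 + (2 * Q i * r i + r i ^ 2) + served rule Q u i ^ 2) :=
    Finset.sum_le_sum fun i _ => sub_sq_add_le _ _ _
  rw [Finset.sum_add_distrib, Finset.sum_add_distrib, Finset.sum_add_distrib,
    ← Finset.mul_sum] at h
  have := sum_served_sq_le hrule Q u
  linarith

/-! ### Expectations over one requirement cycle -/

theorem tsum_roundingLaw_mul (x : ℝ) (f : ℕ → ℝ≥0∞) :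
    ∑' n, roundingLaw x n * f n
      = ENNReal.ofReal (x - ⌊x⌋) * f ⌈x⌉₊ + ENNReal.ofReal (1 - (x - ⌊x⌋)) * f ⌊x⌋₊ := by
  rw [roundingLaw, PMF.tsum_map_mul, tsum_fintype]
  simp

theorem tsum_roundingLaw_quadratic {x : ℝ} (hx : 0 ≤ x) (a : ℕ) :
    ∑' n, roundingLaw x n * ((2 * a * n + n ^ 2 : ℕ) : ℝ≥0∞)
      = ENNReal.ofReal (2 * a * x + ((⌈x⌉ : ℝ) ^ 2 * (x - (⌊x⌋ : ℝ))
          + (⌊x⌋ : ℝ) ^ 2 * (1 - x + (⌊x⌋ : ℝ)))) := by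
  have hf : 0 ≤ x - ⌊x⌋ := Int.fract_nonneg x
  have hf' : 0 ≤ 1 - (x - ⌊x⌋) := by linarith [Int.fract_lt_one x, Int.self_sub_floor x]
  have hc : ((⌈x⌉₊ : ℕ) : ℝ) = (⌈x⌉ : ℝ) := natCast_ceil_eq_intCast_ceil hx
  have hfl : ((⌊x⌋₊ : ℕ) : ℝ) = (⌊x⌋ : ℝ) := natCast_floor_eq_intCast_floor hx
  rw [tsum_roundingLaw_mul, ← ENNReal.ofReal_natCast, ← ENNReal.ofReal_natCast,
    ← ENNReal.ofReal_mul hf, ← ENNReal.ofReal_mul hf',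
    ← ENNReal.ofReal_add (by positivity) (by positivity)]
  congr 1
  push_cast
  rw [hc, hfl]
  -- Rounding is unbiased. At an integer `x` the upper value has weight zero; otherwise the ceiling
  -- is the floor plus one.
  have hmean : (x - ⌊x⌋) * ⌈x⌉ + (1 - (x - ⌊x⌋)) * ⌊x⌋ = x := by
    rcases eq_or_ne (Int.fract x) 0 with h | h
    · have : x - ⌊x⌋ = 0 := h
      rw [this]
      linarith
    · have : (⌈x⌉ : ℝ) = ⌊x⌋ + 1 := by
        exact_mod_cast Int.ceil_eq_floor_add_one_iff_notMem x |>.2 fun hmem =>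
          h (Int.fract_eq_zero_iff.2 hmem)
      rw [this]
      ring
  linear_combination (2 * (a : ℝ)) * hmean

theorem tsum_reqLaw_mul (i : ι) (f : ℕ → ℝ≥0∞) :
    ∑' r, A.reqLaw r * f (r i) = ∑' n, roundingLaw (A.m i) n * f n := by
  rw [← A.reqLaw_marginal i, PMF.tsum_map_mul]

/-- No product of requirements of distinct clients occurs, so the marginals decide and the coupling
is irrelevant. -/
theorem tsum_reqLaw_quadratic (Q : ι → ℕ) :
    ∑' r, A.reqLaw r * ((∑ i, (2 * Q i * r i + r i ^ 2) : ℕ) : ℝ≥0∞)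
      = ENNReal.ofReal (∑ i, (2 * Q i * A.m i + ((⌈A.m i⌉ : ℝ) ^ 2 * (A.m i - (⌊A.m i⌋ : ℝ))
        + (⌊A.m i⌋ : ℝ) ^ 2 * (1 - A.m i + (⌊A.m i⌋ : ℝ))))) := by
  rw [ENNReal.ofReal_sum_of_nonneg]
  · simp_rw [Nat.cast_sum, Finset.mul_sum]
    rw [Summable.tsum_finsetSum fun _ _ => ENNReal.summable]
    refine Finset.sum_congr rfl fun i _ => ?_
    rw [← tsum_roundingLaw_quadratic (A.m_nonneg i),
      ← tsum_reqLaw_mul i fun n => ((2 * Q i * n + n ^ 2 : ℕ) : ℝ≥0∞)]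
  · intro i _
    have h1 : 0 ≤ A.m i - ⌊A.m i⌋ := Int.fract_nonneg _
    have h2 : 0 ≤ 1 - A.m i + ⌊A.m i⌋ := by
      linarith [Int.fract_lt_one (A.m i), Int.self_sub_floor (A.m i)]
    have := A.m_nonneg i
    positivity

theorem rate_nonneg (q : κ) : 0 ≤ A.rate q := mul_nonneg A.arrival_pos.le (A.share_nonneg q)

theorem sum_cycleQueryLaw_apply (j : Fin A.N) (g : Option κ → ℝ≥0∞) :
    ∑ u, A.cycleQueryLaw u * g (u j) = ∑ o, A.queryLaw o * g o := by
  classical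
  -- Absorbing `g` into the `j`-th factor turns the sum into a product of sums, where every other
  -- factor is a total mass 1.
  have hprod : ∀ u : Fin A.N → Option κ, A.cycleQueryLaw u * g (u j)
      = ∏ j', A.queryLaw (u j') * (if j' = j then g (u j') else 1) := by
    intro u
    rw [Finset.prod_mul_distrib, Finset.prod_ite_eq' Finset.univ j fun j' => g (u j')]
    simp [cycleQueryLaw]
  simp_rw [hprod]
  rw [← Fintype.piFinset_univ, ← Finset.prod_univ_sum (fun _ => Finset.univ)
    (fun j' o => A.queryLaw o * (if j' = j then g o else 1)), Finset.prod_eq_single j]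
  · simp
  · intro j' _ hj'
    simp only [hj', if_false, mul_one]
    rw [← tsum_fintype (L := .unconditional _)]
    exact A.queryLaw.tsum_coe
  · simp

/-- `Q` is fixed throughout the cycle, so each time slot contributes a function of its own query
alone. -/
theorem tsum_cycleQueryLaw_served (rule : A.Rule) (Q : ι → ℕ) :
    ∑' u, A.cycleQueryLaw u * ((∑ i, Q i * served rule Q u i : ℕ) : ℝ≥0∞)
      = ENNReal.ofReal (∑ j, ∑ q, A.rate q * ∑ i, (Q i : ℝ) * ∑ s, (rule j q Q i s : ℝ)) := by
  have hexp : ∀ u : Fin A.N → Option κ, ((∑ i, Q i * served rule Q u i : ℕ) : ℝ≥0∞)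
      = ∑ j, (((u j).elim 0 fun q => ∑ i, Q i * ∑ s, rule j q Q i s : ℕ) : ℝ≥0∞) := by
    intro u
    rw [← Nat.cast_sum]
    congr 1
    simp_rw [served, Finset.mul_sum]
    rw [Finset.sum_comm]
    refine Finset.sum_congr rfl fun j _ => ?_
    cases u j <;> simp [Finset.mul_sum]
  rw [tsum_fintype]
  simp_rw [hexp, Finset.mul_sum]
  rw [Finset.sum_comm, ENNReal.ofReal_sum_of_nonneg]
  · refine Finset.sum_congr rfl fun j _ => ?_
    rw [sum_cycleQueryLaw_apply j fun o =>
      ((o.elim 0 fun q => ∑ i, ∑ s, Q i * rule j q Q i s : ℕ) : ℝ≥0∞),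
      Fintype.sum_option, ENNReal.ofReal_sum_of_nonneg]
    · simp only [Option.elim, Nat.cast_zero, mul_zero, zero_add]
      refine Finset.sum_congr rfl fun q _ => ?_
      simp_rw [← Finset.mul_sum]
      rw [ENNReal.ofReal_mul (rate_nonneg q), ← ENNReal.ofReal_natCast]
      simp [queryLaw]
    · intro q _
      have := A.rate_nonneg q
      positivity
  · intro j _
    refine Finset.sum_nonneg fun q _ => ?_
    have := A.rate_nonneg q
    positivity

/-! ### Optimality of the online rule -/

theorem weight_eq {L : ℕ} (M : Matrix ι (Fin L) ℕ) (c : ι → Fin L → ℝ) (ε : ℝ) (Q : ι → ℕ) :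
    ∑ i, ∑ s, (M i s : ℝ) * (c i s / ε + (Q i : ℝ))
      = (∑ i, ∑ s, (M i s : ℝ) * c i s) / ε + ∑ i, (Q i : ℝ) * ∑ s, (M i s : ℝ) := by
  simp_rw [Finset.sum_div, Finset.mul_sum, ← Finset.sum_add_distrib]
  refine Finset.sum_congr rfl fun i _ => Finset.sum_congr rfl fun s _ => by ring

/-- A maximum dominates any average. The policy may have total mass below 1, which is harmless
because the maximal weight is nonnegative. -/
theorem sum_policy_weight_le {ε : ℝ} (hε : 0 < ε) {rule : A.Rule} (hrule : A.IsOnline ε rule)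
    {p : A.Policy} (hp : p ∈ A.relaxedFeasible) (j : Fin A.N) (q : κ) (Q : ι → ℕ) :
    ∑ M : {M // M ∈ A.mats q}, p q M * ∑ i, ∑ s, (M.1 i s : ℝ) * (A.ctr q i s / ε + (Q i : ℝ))
      ≤ ∑ i, ∑ s, (rule j q Q i s : ℝ) * (A.ctr q i s / ε + (Q i : ℝ)) := by
  set w := ∑ i, ∑ s, (rule j q Q i s : ℝ) * (A.ctr q i s / ε + (Q i : ℝ)) with hw
  have hw0 : 0 ≤ w := Finset.sum_nonneg fun i _ => Finset.sum_nonneg fun s _ => by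
    have := A.ctr_nonneg q i s
    positivity
  calc _ ≤ ∑ M : {M // M ∈ A.mats q}, p q M * w :=
        Finset.sum_le_sum fun M _ =>
          mul_le_mul_of_nonneg_left ((hrule j q Q).2 M.1 M.2) (hp.1 q M).1
    _ = (∑ M : {M // M ∈ A.mats q}, p q M) * w := (Finset.sum_mul ..).symm
    _ ≤ 1 * w := mul_le_mul_of_nonneg_right (hp.2 q) hw0
    _ = w := one_mul w

/-- The click-through rate of a deterministic choice of matrices is at most the maximal one. -/
theorem sum_rate_clicks_le (R : (q : κ) → {M // M ∈ A.mats q}) :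
    ∑ q, A.rate q * ∑ i, ∑ s, ((R q).1 i s : ℝ) * A.ctr q i s
      ≤ sSup (A.clickRate '' A.relaxedFeasible) := by
  classical
  refine A.isGreatest_clickRate.2 ⟨fun q M => if M = R q then 1 else 0, ⟨?_, ?_⟩, ?_⟩
  · intro q M
    dsimp only
    split_ifs <;> norm_num
  · intro q
    simp
  · simp [clickRate]

theorem sum_sum_rate_clicks_le {rule : A.Rule} (hrule : ∀ j q Q, rule j q Q ∈ A.mats q)
    (Q : ι → ℕ) :
    ∑ j, ∑ q, A.rate q * ∑ i, ∑ s, (rule j q Q i s : ℝ) * A.ctr q i s ≤ A.D₃ := by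
  have := Finset.sum_le_sum fun j (_ : j ∈ Finset.univ) =>
    sum_rate_clicks_le fun q => ⟨rule j q Q, hrule j q Q⟩
  simpa [D₃] using this

/-- In the weight comparison the clicks of the policy are nonnegative and are dropped, while those
of the rule cost at most `D₃ / ε` over a cycle. -/
theorem sum_mul_impressions_le {ε : ℝ} (hε : 0 < ε) {rule : A.Rule} (hrule : A.IsOnline ε rule)
    {p : A.Policy} (hp : p ∈ A.relaxedFeasible) (Q : ι → ℕ) :
    ∑ i, (Q i : ℝ) * A.impressions p i
      ≤ ∑ j, ∑ q, A.rate q * ∑ i, (Q i : ℝ) * ∑ s, (rule j q Q i s : ℝ) + A.D₃ / ε := by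
  have hpolicy : ∑ i, (Q i : ℝ) * A.impressions p i = ∑ _j : Fin A.N, ∑ q, A.rate q *
      ∑ M : {M // M ∈ A.mats q}, p q M * ∑ i, (Q i : ℝ) * ∑ s, (M.1 i s : ℝ) := by
    rw [Finset.sum_const, Finset.card_univ, Fintype.card_fin, nsmul_eq_mul]
    simp_rw [impressions, Finset.mul_sum]
    rw [Finset.sum_comm]
    refine Finset.sum_congr rfl fun q _ => ?_
    rw [Finset.sum_comm]
    refine Finset.sum_congr rfl fun M _ => Finset.sum_congr rfl fun i _ =>
      Finset.sum_congr rfl fun s _ => by ring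
  have hle : ∀ j q, ∑ M : {M // M ∈ A.mats q}, p q M * ∑ i, (Q i : ℝ) * ∑ s, (M.1 i s : ℝ)
      ≤ (∑ i, ∑ s, (rule j q Q i s : ℝ) * A.ctr q i s) / ε
        + ∑ i, (Q i : ℝ) * ∑ s, (rule j q Q i s : ℝ) := by
    intro j q
    rw [← weight_eq]
    refine le_trans (Finset.sum_le_sum fun M _ => ?_) (sum_policy_weight_le hε hrule hp j q Q)
    rw [weight_eq]
    refine mul_le_mul_of_nonneg_left (le_add_of_nonneg_left ?_) (hp.1 q M).1
    refine div_nonneg (Finset.sum_nonneg fun i _ => Finset.sum_nonneg fun s _ => ?_) hε.le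
    exact mul_nonneg (Nat.cast_nonneg _) (A.ctr_nonneg q i s)
  rw [hpolicy]
  calc _ ≤ ∑ j, ∑ q, A.rate q * ((∑ i, ∑ s, (rule j q Q i s : ℝ) * A.ctr q i s) / ε
        + ∑ i, (Q i : ℝ) * ∑ s, (rule j q Q i s : ℝ)) :=
        Finset.sum_le_sum fun j _ => Finset.sum_le_sum fun q _ =>
          mul_le_mul_of_nonneg_left (hle j q) (A.rate_nonneg q)
    _ = ∑ j, ∑ q, A.rate q * ∑ i, (Q i : ℝ) * ∑ s, (rule j q Q i s : ℝ)
        + (∑ j, ∑ q, A.rate q * ∑ i, ∑ s, (rule j q Q i s : ℝ) * A.ctr q i s) / ε := by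
        rw [add_comm, Finset.sum_div, ← Finset.sum_add_distrib]
        refine Finset.sum_congr rfl fun j _ => ?_
        rw [Finset.sum_div, ← Finset.sum_add_distrib]
        exact Finset.sum_congr rfl fun q _ => by ring
    _ ≤ _ := by
        gcongr
        exact sum_sum_rate_clicks_le (fun j q Q => (hrule j q Q).1) Q

/-! ### The drift of the credit queues -/

theorem tsum_step_sq_add_le {rule : A.Rule} (hrule : ∀ j q Q, rule j q Q ∈ A.mats q)
    (Q : ι → ℕ) :
    ∑' x, step rule Q x * ((∑ i, x i ^ 2 : ℕ) : ℝ≥0∞)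
      + ENNReal.ofReal (2 * ∑ j, ∑ q, A.rate q * ∑ i, (Q i : ℝ) * ∑ s, (rule j q Q i s : ℝ))
      ≤ ((∑ i, Q i ^ 2 + (A.N * (A.N - 1) * A.L ^ 2 + A.N * A.L) : ℕ) : ℝ≥0∞)
        + ENNReal.ofReal (∑ i, (2 * Q i * A.m i + ((⌈A.m i⌉ : ℝ) ^ 2 * (A.m i - (⌊A.m i⌋ : ℝ))
        + (⌊A.m i⌋ : ℝ) ^ 2 * (1 - A.m i + (⌊A.m i⌋ : ℝ))))) := by
  rw [ENNReal.ofReal_mul zero_le_two, ENNReal.ofReal_ofNat, ← tsum_cycleQueryLaw_served,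
    ← tsum_reqLaw_quadratic, step, PMF.tsum_bind_mul, ← ENNReal.tsum_mul_left,
    ← ENNReal.tsum_add]
  simp_rw [PMF.tsum_map_mul]
  set B : ℕ := ∑ i, Q i ^ 2 + (A.N * (A.N - 1) * A.L ^ 2 + A.N * A.L)
  -- Constants are rewritten as averages over `u`, and below over `r`, so that the claim reduces to
  -- the pathwise inequality.
  rw [← PMF.tsum_mul_const A.cycleQueryLaw ((B : ℝ≥0∞) + _)]
  refine ENNReal.tsum_le_tsum fun u => ?_
  rw [mul_left_comm, ← mul_add]
  refine mul_le_mul' le_rfl ?_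
  conv_lhs => rw [← PMF.tsum_mul_const A.reqLaw (2 * _)]
  conv_rhs => rw [← PMF.tsum_mul_const A.reqLaw (B : ℝ≥0∞)]
  rw [← ENNReal.tsum_add, ← ENNReal.tsum_add]
  refine ENNReal.tsum_le_tsum fun r => ?_
  rw [← mul_add, ← mul_add]
  refine mul_le_mul' le_rfl ?_
  exact_mod_cast sum_update_sq_add_le hrule Q u r

theorem D₃_nonneg : 0 ≤ A.D₃ := by
  refine mul_nonneg (Nat.cast_nonneg _) (A.isGreatest_clickRate.2 ⟨fun _ _ => 0, ?_, ?_⟩)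
  · simp [relaxedFeasible]
  · simp [clickRate]

theorem D₁_nonneg : 0 ≤ A.D₁ := by
  have hN : (1 : ℝ) ≤ A.N := by exact_mod_cast A.N_pos
  have hN' : (0 : ℝ) ≤ (A.N : ℝ) - 1 := by linarith
  have hS : 0 ≤ ∑ i, ((⌈A.m i⌉ : ℝ) ^ 2 * (A.m i - (⌊A.m i⌋ : ℝ))
        + (⌊A.m i⌋ : ℝ) ^ 2 * (1 - A.m i + (⌊A.m i⌋ : ℝ))) := by
    refine Finset.sum_nonneg fun i _ => ?_
    have h1 : 0 ≤ A.m i - ⌊A.m i⌋ := Int.fract_nonneg _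
    have h2 : 0 ≤ 1 - A.m i + ⌊A.m i⌋ := by
      linarith [Int.fract_lt_one (A.m i), Int.self_sub_floor (A.m i)]
    positivity
  unfold D₁
  positivity

/-- A maximizer of `D₂` serves every client with surplus at least `D₂max`; comparing the rule with
it gives the constant `D₂max`. -/
theorem D₂max_mul_sum_le [Nonempty ι] {ε : ℝ} (hε : 0 < ε) {rule : A.Rule}
    (hrule : A.IsOnline ε rule) (Q : ι → ℕ) :
    A.D₂max * ∑ i, (Q i : ℝ) + ∑ i, (Q i : ℝ) * A.m i
      ≤ ∑ j, ∑ q, A.rate q * ∑ i, (Q i : ℝ) * ∑ s, (rule j q Q i s : ℝ) + A.D₃ / ε := by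
  obtain ⟨p, hp, hpD⟩ := A.isGreatest_D₂max.1
  refine le_trans ?_ (sum_mul_impressions_le hε hrule hp Q)
  rw [Finset.mul_sum, ← Finset.sum_add_distrib]
  refine Finset.sum_le_sum fun i _ => ?_
  have : A.D₂max ≤ A.impressions p i - A.m i := by
    rw [← hpD]
    exact Finset.inf'_le _ (Finset.mem_univ i)
  nlinarith [(Nat.cast_nonneg (Q i) : (0 : ℝ) ≤ Q i)]

/-- Foster–Lyapunov drift condition for `∑ i, Q i ^ 2`. -/
theorem tsum_step_sq_drift [Nonempty ι] {ε : ℝ} (hε : 0 < ε) (hD : 0 < A.D₂max) {rule : A.Rule}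
    (hrule : A.IsOnline ε rule) (Q : ι → ℕ) :
    ∑' x, step rule Q x * ((∑ i, x i ^ 2 : ℕ) : ℝ≥0∞)
      + ENNReal.ofReal (2 * A.D₂max) * ((∑ i, Q i : ℕ) : ℝ≥0∞)
      ≤ ((∑ i, Q i ^ 2 : ℕ) : ℝ≥0∞) + ENNReal.ofReal (2 * (A.D₁ + A.D₃ / ε)) := by
  have hstep := tsum_step_sq_add_le (fun j q Q => (hrule j q Q).1) Q
  have hopt := D₂max_mul_sum_le hε hrule Q
  set e := ∑ j, ∑ q, A.rate q * ∑ i, (Q i : ℝ) * ∑ s, (rule j q Q i s : ℝ) with he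
  have he0 : 0 ≤ e := Finset.sum_nonneg fun j _ => Finset.sum_nonneg fun q _ => by
    have := A.rate_nonneg q
    positivity
  have hB : 0 ≤ A.D₁ + A.D₃ / ε := add_nonneg D₁_nonneg (div_nonneg D₃_nonneg hε.le)
  have hN : ((A.N - 1 : ℕ) : ℝ) = (A.N : ℝ) - 1 := by
    rw [Nat.cast_sub A.N_pos, Nat.cast_one]
  -- The finite quantity `2 * e`, twice the expected queue-weighted service, is added to both sides
  -- to match `hstep`; all terms are then nonnegative reals and the comparison moves to `ℝ`.
  rw [← ENNReal.add_le_add_iff_right (ENNReal.ofReal_ne_top (r := 2 * e)), add_right_comm]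
  refine (add_le_add_left hstep _).trans ?_
  have hm : 0 ≤ ∑ i, (2 * Q i * A.m i + ((⌈A.m i⌉ : ℝ) ^ 2 * (A.m i - (⌊A.m i⌋ : ℝ))
        + (⌊A.m i⌋ : ℝ) ^ 2 * (1 - A.m i + (⌊A.m i⌋ : ℝ)))) := by
    refine Finset.sum_nonneg fun i _ => ?_
    have h1 : 0 ≤ A.m i - ⌊A.m i⌋ := Int.fract_nonneg _
    have h2 : 0 ≤ 1 - A.m i + ⌊A.m i⌋ := by
      linarith [Int.fract_lt_one (A.m i), Int.self_sub_floor (A.m i)]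
    have := A.m_nonneg i
    positivity
  rw [← ENNReal.ofReal_natCast, ← ENNReal.ofReal_natCast (∑ i, Q i),
    ← ENNReal.ofReal_natCast (∑ i, Q i ^ 2), ← ENNReal.ofReal_mul (by positivity),
    ← ENNReal.ofReal_add (Nat.cast_nonneg _) hm, ← ENNReal.ofReal_add (by positivity)
      (by positivity), ← ENNReal.ofReal_add (by positivity) (by positivity),
    ← ENNReal.ofReal_add (by positivity) (by positivity)]
  refine ENNReal.ofReal_le_ofReal ?_
  have hsplit : ∑ i, (2 * (Q i : ℝ) * A.m i) = 2 * ∑ i, (Q i : ℝ) * A.m i := by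
    simp_rw [Finset.mul_sum, mul_assoc]
  rw [Finset.sum_add_distrib, hsplit]
  push_cast
  rw [hN, D₁]
  linarith

theorem queueLaw_eq_nStep (rule : A.Rule) (Q₀ : ι → ℕ) (k : ℕ) :
    queueLaw rule Q₀ k = PMF.nStep (step rule) Q₀ k := by
  induction k with
  | zero => rfl
  | succ k ih => rw [queueLaw, ih, PMF.nStep]

/-- Supplies the finite sublevel sets behind tightness. -/
theorem finite_setOf_sum_le (n : ℕ) : {Q : ι → ℕ | ∑ i, Q i ≤ n}.Finite := by
  classical
  refine (Set.Finite.pi' fun _ : ι => Set.finite_Iic n).subset fun Q hQ i => ?_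
  exact (Finset.single_le_sum (fun _ _ => Nat.zero_le _) (Finset.mem_univ i)).trans hQ

end AdModel

theorem mainTheorem5 {κ ι : Type*} [Fintype κ] [Fintype ι] [Nonempty ι]
    (A : AdModel κ ι) (ε : ℝ) (hε : 0 < ε)
    (hslater : ∃ p ∈ A.feasible, 0 < A.D₂ p)
    (rule : A.Rule) (hrule : A.IsOnline ε rule) :
    (∃ π : PMF (ι → ℕ), AdModel.IsSteadyState rule π) ∧
    (∀ π : PMF (ι → ℕ), AdModel.IsSteadyState rule π →
      meanTotal π ≤ ENNReal.ofReal ((A.D₁ + A.D₃ / ε) / A.D₂max)) ∧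
    (∀ Q₀ : ι → ℕ,
      Filter.limsup (fun K : ℕ =>
          (∑ k ∈ Finset.range K, meanTotal (AdModel.queueLaw rule Q₀ k)) / (K : ENNReal))
        Filter.atTop ≤ ENNReal.ofReal ((A.D₁ + A.D₃ / ε) / A.D₂max)) := by
  -- The Slater point serves only to make `D₂max` positive.
  have hD : 0 < A.D₂max := by
    obtain ⟨p, hp, hpos⟩ := hslater
    exact hpos.trans_le (A.isGreatest_D₂max.2 ⟨p, hp.1, rfl⟩)
  have hdrift := AdModel.tsum_step_sq_drift hε hD hrule
  have hd : ENNReal.ofReal (2 * A.D₂max) ≠ 0 := by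
    rw [ne_eq, ENNReal.ofReal_eq_zero, not_le]
    positivity
  have hd' := ENNReal.ofReal_ne_top (r := 2 * A.D₂max)
  have hW : ∀ Q : ι → ℕ, ((∑ i, Q i ^ 2 : ℕ) : ℝ≥0∞) ≠ ∞ := fun _ => ENNReal.natCast_ne_top _
  -- The factor 2 of the quadratic drift appears in both constants and cancels.
  have hconst : ENNReal.ofReal ((A.D₁ + A.D₃ / ε) / A.D₂max)
      = ENNReal.ofReal (2 * (A.D₁ + A.D₃ / ε)) / ENNReal.ofReal (2 * A.D₂max) := by
    rw [← ENNReal.ofReal_div_of_pos (by positivity), mul_div_mul_left _ _ two_ne_zero]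
  rw [hconst]
  refine ⟨PMF.exists_stationary_of_drift hd hd' ENNReal.ofReal_ne_top hW
      AdModel.finite_setOf_sum_le hdrift 0,
    fun π hπ => PMF.tsum_mul_le_of_drift hd hd' hW hdrift hπ, fun Q₀ => ?_⟩
  simp_rw [AdModel.queueLaw_eq_nStep]
  exact PMF.limsup_average_nStep_le_of_drift hd hd' hW hdrift Q₀
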